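/- Let $\alpha\ge 0$, $\sigma\ge 0$, let $\pi$ be a measure on $(0,\infty)$ with $\int_{(0,\infty)} (r\wedge r^2)\,\pi(dr)<\infty$, and let $$\psi(\lambda)=\alpha\lambda+\tfrac12\sigma^2\lambda^2+\int_{(0,\infty)}\bigl(e^{-\lambda r}-1+\lambda r\bigr)\,\pi(dr),\qquad \lambda\ge 0 .$$ Assume that $\int^{\infty}\frac{d\lambda}{\psi(\lambda)}<\infty$, that is, $\int_c^\infty \frac{d\lambda}{\psi(\lambda)}<\infty$ for some $c>0$ (with $1/0=+\infty$). Let $(Z_t)_{t\ge 0}$ with probabilities $\{P_x : x>0\}$ be a (critical or subcritical) continuous-state branching process with branching mechanism $\psi$: a $[0,\infty)$-valued time-homogeneous strong Markov process with right-continuous paths having left limits, with $P_x(Z_0=x)=1$, with absorbing state $0$, and such that $E_x[e^{-\lambda Z_t}]=e^{-x u_t(\lambda)}$ for all $x,\lambda>0$ and $t\ge 0$, where $u_t(\lambda)\ge 0$ solves $\frac{\partial}{\partial t}u_t(\lambda)=-\psi(u_t(\lambda))$, $u_0(\lambda)=\lambda$. Let $W$ be the scale function of $\psi$, that is, the unique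 function that vanishes on $(-\infty,0)$, is nonnegative, continuous and strictly increasing on $[0,\infty)$, and satisfies $\int_0^\infty e^{-\lambda x}W(x)\,dx=1/\psi(\lambda)$ for all $\lambda>0$. Call a Radon (i.e. locally finite Borel) measure $\nu$ on $(0,\infty)$ a stationary measure for $Z$ if $\int_{(0,\infty)}P_x(Z_t\in A)\,\nu(dx)=\nu(A)$ for every $t>0$ and every Borel set $A\subseteq(0,\infty)$. Then the measure $\mu(dx)=\frac{W(x)}{x}\,dx$ on $(0,\infty)$ is a nonzero stationary measure for $Z$, and it is unique up to a constant multiple: every stationary measure $\nu$ for $Z$ is of the form $\nu=c\,\mu$ with a constant $c\in[0,\infty)$. -/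

import Mathlib

open MeasureTheory ProbabilityTheory Set Filter Topology
open scoped NNReal ENNReal

noncomputable section

namespace CBProcess

/-- The open half-line `(0, ∞)`, with the topology and Borel σ-algebra of a subtype of `ℝ`. -/
abbrev PosReal : Type := Set.Ioi (0 : ℝ)

/-- The Lévy-Khintchine data of a branching mechanism: `α ∈ ℝ`, `σ ≥ 0` and a measure `π` on
`(0, ∞)` with `∫ r ∧ r² π(dr) < ∞` (which forces `π` to be a Radon measure on `(0, ∞)`). -/
structure BranchingMechanism where
  α : ℝ
  σ : ℝ
  σ_nonneg : 0 ≤ σ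
  π : Measure PosReal
  lintegral_min_lt_top : ∫⁻ r : PosReal, ENNReal.ofReal (min (r : ℝ) ((r : ℝ) ^ 2)) ∂π < ∞

namespace BranchingMechanism

/-- The branching mechanism
`ψ(z) = α z + σ² z² / 2 + ∫_{(0,∞)} (e^{-z r} - 1 + z r) π(dr)`, for `z ≥ 0`. -/
def psi (Ψ : BranchingMechanism) (z : ℝ) : ℝ :=
  Ψ.α * z + 1 / 2 * Ψ.σ ^ 2 * z ^ 2
    + ∫ r : PosReal, (Real.exp (-z * (r : ℝ)) - 1 + z * (r : ℝ)) ∂Ψ.π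

/-- Critical (`α = 0`) or subcritical (`α > 0`); here `α = ψ'(0+)`. -/
def IsCriticalOrSubcritical (Ψ : BranchingMechanism) : Prop := 0 ≤ Ψ.α

/-- The condition `∫^∞ dz / ψ(z) < ∞`: the integral over some half-line `(c, ∞)` is finite.
The quotient is taken in `[0, ∞]`, so that it is `∞` where `ψ` vanishes. -/
def IntegralInvFinite (Ψ : BranchingMechanism) : Prop :=
  ∃ c : ℝ, 0 < c ∧ ∫⁻ z in Set.Ioi c, (ENNReal.ofReal (Ψ.psi z))⁻¹ < ∞

/-- `u t z` (`t ≥ 0`, `z > 0`) is the nonnegative solution of the initial value problem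
`∂u_t(z)/∂t = -ψ(u_t(z))`, `u_0(z) = z`. -/
def IsCumulant (Ψ : BranchingMechanism) (u : ℝ → ℝ → ℝ) : Prop :=
  ∀ z : ℝ, 0 < z → u 0 z = z ∧
    ∀ t : ℝ, 0 ≤ t → 0 ≤ u t z ∧
      HasDerivWithinAt (fun s => u s z) (-Ψ.psi (u t z)) (Set.Ici 0) t

/-- `W` is the scale function of `ψ`: the function that vanishes on `(-∞, 0)`, is continuous,
nonnegative and strictly increasing on `[0, ∞)` (hence positive on `(0, ∞)`), and satisfies
`∫_0^∞ e^{-z x} W(x) dx = 1 / ψ(z)` for `z > 0`. -/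
structure IsScaleFunction (Ψ : BranchingMechanism) (W : ℝ → ℝ) : Prop where
  eq_zero_of_neg : ∀ x : ℝ, x < 0 → W x = 0
  continuousOn : ContinuousOn W (Set.Ici 0)
  strictMonoOn : StrictMonoOn W (Set.Ici 0)
  nonneg : ∀ x : ℝ, 0 ≤ x → 0 ≤ W x
  integrableOn : ∀ z : ℝ, 0 < z →
    IntegrableOn (fun x => Real.exp (-z * x) * W x) (Set.Ioi 0)
  laplace : ∀ z : ℝ, 0 < z →
    ∫ x in Set.Ioi (0 : ℝ), Real.exp (-z * x) * W x = 1 / Ψ.psi z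

end BranchingMechanism

/-- The law of `Z_t` started from `y`, for the family of laws `P x`, `x > 0`, completed by
absorption at the state `0`: from `0` the process stays at `0`. -/
def transition {Ω : Type*} [MeasurableSpace Ω] (P : PosReal → Measure Ω)
    (Z : ℝ≥0 → Ω → ℝ) (t : ℝ≥0) (y : ℝ) (B : Set ℝ) : ℝ≥0∞ :=
  open Classical in
  if hy : 0 < y then P ⟨y, hy⟩ (Z t ⁻¹' B) else Measure.dirac 0 B

/-- `(Z, (P x)_{x > 0})` is a continuous-state branching process with branching mechanism `ψ`:
a `[0, ∞)`-valued time-homogeneous strong Markov process with càdlàg paths, started from `x`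
under `P x`, with absorbing state `0`, whose one-dimensional laws are given by
`E_x[e^{-z Z_t}] = e^{-x u_t(z)}` (this form contains the branching property). -/
structure IsCBProcess (Ψ : BranchingMechanism) {Ω : Type*} [MeasurableSpace Ω]
    (P : PosReal → Measure Ω) (Z : ℝ≥0 → Ω → ℝ) : Prop where
  isProbabilityMeasure : ∀ x, IsProbabilityMeasure (P x)
  measurable : ∀ t, StronglyMeasurable (Z t)
  nonneg : ∀ t ω, 0 ≤ Z t ω
  right_continuous : ∀ ω t, ContinuousWithinAt (fun s => Z s ω) (Set.Ici t) t
  left_limits : ∀ ω (t : ℝ≥0), 0 < t → ∃ l : ℝ, Tendsto (fun s => Z s ω) (𝓝[<] t) (𝓝 l)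
  initial : ∀ x : PosReal, P x {ω | Z 0 ω = (x : ℝ)} = 1
  measurable_transition : ∀ (t : ℝ≥0) (B : Set ℝ), MeasurableSet B →
    Measurable fun y => transition P Z t y B
  /-- The strong Markov property, for the natural filtration of `Z`: given the past up to a
  stopping time `τ`, on `{τ < ∞}` the law of `Z_{τ + t}` is that of `Z_t` started from `Z_τ`. -/
  strong_markov : ∀ (τ : Ω → WithTop ℝ≥0)
    (hτ : IsStoppingTime (Filtration.natural Z measurable) τ) (x : PosReal) (t : ℝ≥0)
    (A : Set Ω), MeasurableSet[hτ.measurableSpace] A → ∀ B : Set ℝ, MeasurableSet B →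
      P x (A ∩ {ω | τ ω ≠ ⊤ ∧ Z ((τ ω).untopD 0 + t) ω ∈ B})
        = ∫⁻ ω in A ∩ {ω | τ ω ≠ ⊤}, transition P Z t (Z ((τ ω).untopD 0) ω) B ∂(P x)
  log_laplace : ∃ u : ℝ → ℝ → ℝ, Ψ.IsCumulant u ∧
    ∀ (x : PosReal) (t : ℝ≥0) (z : ℝ), 0 < z →
      ∫ ω, Real.exp (-z * Z t ω) ∂(P x) = Real.exp (-(x : ℝ) * u (t : ℝ) z)

/-- `ν` is a stationary measure on `(0, ∞)`: a Radon measure with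
`∫_{(0,∞)} P_x(Z_t ∈ A) ν(dx) = ν(A)` for all `t > 0` and all Borel sets `A ⊆ (0, ∞)`. -/
structure IsStationaryMeasure {Ω : Type*} [MeasurableSpace Ω] (P : PosReal → Measure Ω)
    (Z : ℝ≥0 → Ω → ℝ) (ν : Measure PosReal) : Prop where
  isLocallyFinite : IsLocallyFiniteMeasure ν
  stationary : ∀ t : ℝ≥0, 0 < t → ∀ A : Set PosReal, MeasurableSet A →
    ∫⁻ x, P x {ω | Z t ω ∈ ((↑) : PosReal → ℝ) '' A} ∂ν = ν A

/-- The measure `(W(x) / x) dx` on `(0, ∞)`. -/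
def scaleMeasure (W : ℝ → ℝ) : Measure PosReal :=
  (Measure.comap ((↑) : PosReal → ℝ) volume).withDensity fun x => ENNReal.ofReal (W (x : ℝ) / (x : ℝ))

end CBProcess

end

/-! Test functions `e^{-zx} - e^{-wx}` vanish at `0`, so mass absorbed at `0` is invisible to them,
and the transition kernel sends them to `e^{-u_t(z)x} - e^{-u_t(w)x}`. With `g(s) = ∫ x e^{-sx}
ν(dx)` (`laplaceDeriv`), Tonelli turns stationarity of `ν`, tested on these functions, into
`∫_{u_t(z)}^{u_t(w)} g = ∫_z^w g`: the measure `g(s) ds` is invariant under the flow of `u' =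
-ψ(u)`.

The density `1/ψ` is invariant because `∫ ds/ψ(s)` measures travel time along the flow, and it is
exactly `g` for `(W(x)/x) dx`; this gives existence. Conversely, differentiating the invariance at
`t = 0` shows that `gψ` is constant (`laplaceDeriv_mul_psi_eq`), and `g` determines `ν`; this gives
uniqueness.

The uniqueness argument needs `g < ∞` for an arbitrary Radon `ν`. Since `∫^∞ ds/ψ(s) < ∞`, the
cumulant at a large time lies below any prescribed `v > 0` (`exists_cumulant_le`), which yields
`P_x(Z_t ∈ [a,b]) ≥ c (x ∧ 1) e^{-vx}` for some compact `[a,b] ⊆ (0,∞)` (`exists_le_measure_Icc`).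
Integrating against `ν` bounds `g` by a multiple of `ν[a,b] < ∞`. -/

/-! ### Uniqueness for Laplace transforms. -/

lemma integrable_exp_neg_mul_of_lintegral_ne_top {m : Measure ℝ} {z : ℝ}
    (h : ∫⁻ x, ENNReal.ofReal (Real.exp (-z * x)) ∂m ≠ ∞) :
    Integrable (fun x => Real.exp (-z * x)) m := by
  refine ⟨by fun_prop, ?_⟩
  rw [hasFiniteIntegral_iff_ofReal (Eventually.of_forall fun x => (Real.exp_pos _).le)]
  exact h.lt_top

/-- Identity theorem: both transforms are analytic on the open left half-plane and agree on the
negative reals, which accumulate at `-1`. -/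
lemma complexMGF_id_eq_of_lintegral_exp_neg_eq {m₁ m₂ : Measure ℝ}
    (hfin : ∀ z : ℝ, 0 < z → ∫⁻ x, ENNReal.ofReal (Real.exp (-z * x)) ∂m₁ ≠ ∞)
    (h : ∀ z : ℝ, 0 < z → ∫⁻ x, ENNReal.ofReal (Real.exp (-z * x)) ∂m₁
      = ∫⁻ x, ENNReal.ofReal (Real.exp (-z * x)) ∂m₂) :
    EqOn (complexMGF id m₁) (complexMGF id m₂) {z : ℂ | z.re ∈ Iio (0 : ℝ)} := by
  have hfin₂ : ∀ z : ℝ, 0 < z → ∫⁻ x, ENNReal.ofReal (Real.exp (-z * x)) ∂m₂ ≠ ∞ :=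
    fun z hz => h z hz ▸ hfin z hz
  have hsub : ∀ {m : Measure ℝ},
      (∀ z : ℝ, 0 < z → ∫⁻ x, ENNReal.ofReal (Real.exp (-z * x)) ∂m ≠ ∞) →
      {z : ℂ | z.re ∈ Iio (0 : ℝ)} ⊆ {z : ℂ | z.re ∈ interior (integrableExpSet id m)} := by
    intro m hm
    have : Iio (0 : ℝ) ⊆ interior (integrableExpSet id m) := by
      refine interior_maximal (fun z hz => ?_) isOpen_Iio
      have := integrable_exp_neg_mul_of_lintegral_ne_top (hm (-z) (by simpa using hz))
      simpa [integrableExpSet] using this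
    exact fun z hz => this hz
  have hX : AnalyticOnNhd ℂ (complexMGF id m₁) {z : ℂ | z.re ∈ Iio (0 : ℝ)} :=
    analyticOnNhd_complexMGF.mono (hsub hfin)
  have hY : AnalyticOnNhd ℂ (complexMGF id m₂) {z : ℂ | z.re ∈ Iio (0 : ℝ)} :=
    analyticOnNhd_complexMGF.mono (hsub hfin₂)
  have hreal : ∀ y : ℝ, y < 0 → complexMGF id m₁ y = complexMGF id m₂ y := by
    intro y hy
    rw [complexMGF_ofReal, complexMGF_ofReal]
    have := h (-y) (by simpa using hy)
    congr 1
    simp only [mgf, id]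
    rw [integral_eq_lintegral_of_nonneg_ae (Eventually.of_forall fun x => (Real.exp_pos _).le)
      (by fun_prop), integral_eq_lintegral_of_nonneg_ae
      (Eventually.of_forall fun x => (Real.exp_pos _).le) (by fun_prop)]
    simp only [neg_neg] at this
    rw [this]
  refine AnalyticOnNhd.eqOn_of_preconnected_of_frequently_eq hX hY
    ((convex_Iio 0).linear_preimage Complex.reLm).isPreconnected
    (z₀ := ((-1 : ℝ) : ℂ)) (by simp) ?_
  have h_ev : ∀ᶠ y : ℝ in 𝓝[≠] (-1), complexMGF id m₁ y = complexMGF id m₂ y :=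
    (eventually_nhdsWithin_of_eventually_nhds
      (eventually_lt_nhds (by norm_num : (-1 : ℝ) < 0))).mono hreal
  have hmap : Tendsto (fun y : ℝ => (y : ℂ)) (𝓝[≠] (-1)) (𝓝[≠] ((-1 : ℝ) : ℂ)) := by
    refine tendsto_nhdsWithin_iff.2 ⟨(Complex.continuous_ofReal.tendsto _).mono_left
      nhdsWithin_le_nhds, ?_⟩
    filter_upwards [self_mem_nhdsWithin] with y hy
    simpa only [mem_compl_iff, mem_singleton_iff, Complex.ofReal_inj] using hy
  exact hmap.frequently h_ev.frequently

/-- A measure on the line is determined by its Laplace transform on `(0, ∞)`. -/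
lemma Measure_ext_of_lintegral_exp_neg {m₁ m₂ : Measure ℝ}
    (hfin : ∀ z : ℝ, 0 < z → ∫⁻ x, ENNReal.ofReal (Real.exp (-z * x)) ∂m₁ ≠ ∞)
    (h : ∀ z : ℝ, 0 < z → ∫⁻ x, ENNReal.ofReal (Real.exp (-z * x)) ∂m₁
      = ∫⁻ x, ENNReal.ofReal (Real.exp (-z * x)) ∂m₂) : m₁ = m₂ := by
  have heq := complexMGF_id_eq_of_lintegral_exp_neg_eq hfin h
  -- The tilt by `e^{-x}` makes both measures finite, and the characteristic function of a tilted
  -- measure is its `complexMGF` on the line `Re = -1`. The density is positive and finite, so the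
  -- tilt can be undone.
  set f : ℝ → ℝ≥0∞ := fun x => ENNReal.ofReal (Real.exp (-1 * x)) with hf
  have hfm : Measurable f := by fun_prop
  have hf1 : IsFiniteMeasure (m₁.withDensity f) :=
    isFiniteMeasure_withDensity (hfin 1 one_pos)
  have hf2 : IsFiniteMeasure (m₂.withDensity f) :=
    isFiniteMeasure_withDensity (h 1 one_pos ▸ hfin 1 one_pos)
  have hchar : ∀ (m : Measure ℝ) (t : ℝ),
      charFun (m.withDensity f) t = complexMGF id m (-1 + t * Complex.I) := by
    intro m t
    rw [charFun_apply_real, complexMGF, integral_withDensity_eq_integral_toReal_smul hfm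
      (Eventually.of_forall fun x => ENNReal.ofReal_lt_top)]
    refine integral_congr_ae (Eventually.of_forall fun x => ?_)
    simp only [hf, ENNReal.toReal_ofReal (Real.exp_pos _).le, Complex.real_smul, id,
      Complex.ofReal_exp, ← Complex.exp_add]
    congr 1
    push_cast
    ring
  have key : m₁.withDensity f = m₂.withDensity f := by
    refine Measure.ext_of_charFun (funext fun t => ?_)
    rw [hchar, hchar]
    exact heq (by simp)
  have hne : ∀ x, f x ≠ 0 := fun x => by simp [hf, Real.exp_pos]
  have hnt : ∀ x, f x ≠ ∞ := fun x => by simp [hf]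
  rw [← withDensity_inv_same (μ := m₁) hfm (Eventually.of_forall hne) (Eventually.of_forall hnt),
    key, withDensity_inv_same hfm (Eventually.of_forall hne) (Eventually.of_forall hnt)]

namespace CBProcess

lemma measure_posReal_ext_of_lintegral_exp_neg {m₁ m₂ : Measure PosReal}
    (hfin : ∀ z : ℝ, 0 < z → ∫⁻ x, ENNReal.ofReal (Real.exp (-z * (x : ℝ))) ∂m₁ ≠ ∞)
    (h : ∀ z : ℝ, 0 < z → ∫⁻ x, ENNReal.ofReal (Real.exp (-z * (x : ℝ))) ∂m₁
      = ∫⁻ x, ENNReal.ofReal (Real.exp (-z * (x : ℝ))) ∂m₂) : m₁ = m₂ := by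
  have hemb : MeasurableEmbedding ((↑) : PosReal → ℝ) :=
    MeasurableEmbedding.subtype_coe measurableSet_Ioi
  have hmap : m₁.map ((↑) : PosReal → ℝ) = m₂.map ((↑) : PosReal → ℝ) := by
    refine Measure_ext_of_lintegral_exp_neg (fun z hz => ?_) (fun z hz => ?_)
    · rw [hemb.lintegral_map]; exact hfin z hz
    · rw [hemb.lintegral_map, hemb.lintegral_map]; exact h z hz
  rw [← hemb.comap_map m₁, hmap, hemb.comap_map]

/-! ### The differentiated Laplace transform. -/

/-- Minus the derivative of the Laplace transform of `ν`. -/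
noncomputable def laplaceDeriv (ν : Measure PosReal) (z : ℝ) : ℝ≥0∞ :=
  ∫⁻ x : PosReal, ENNReal.ofReal ((x : ℝ) * Real.exp (-z * (x : ℝ))) ∂ν

lemma setLIntegral_Ioc_mul_exp {x z w : ℝ} (hx : 0 < x) (hzw : z ≤ w) :
    ∫⁻ s in Ioc z w, ENNReal.ofReal (x * Real.exp (-s * x))
      = ENNReal.ofReal (Real.exp (-z * x) - Real.exp (-w * x)) := by
  have hint : IntervalIntegrable (fun s => x * Real.exp (-s * x)) volume z w :=
    (by fun_prop : Continuous fun s => x * Real.exp (-s * x)).intervalIntegrable _ _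
  rw [← ofReal_integral_eq_lintegral_ofReal
    ((intervalIntegrable_iff_integrableOn_Ioc_of_le hzw).1 hint)
    (Eventually.of_forall fun s => by positivity),
    ← intervalIntegral.integral_of_le hzw]
  have hder : ∀ s ∈ uIcc z w, HasDerivAt (fun s => -Real.exp (-s * x)) (x * Real.exp (-s * x)) s := by
    intro s _
    have h := (((hasDerivAt_id s).neg.mul_const x).exp).neg
    refine h.congr_deriv ?_
    change -(Real.exp (-s * x) * (-1 * x)) = x * Real.exp (-s * x)
    ring
  rw [intervalIntegral.integral_eq_sub_of_hasDerivAt hder hint]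
  ring_nf

lemma setLIntegral_Ioi_mul_exp {x z : ℝ} (hx : 0 < x) :
    ∫⁻ s in Ioi z, ENNReal.ofReal (x * Real.exp (-s * x))
      = ENNReal.ofReal (Real.exp (-z * x)) := by
  have hi : IntegrableOn (fun s => Real.exp (-x * s)) (Ioi z) :=
    integrableOn_exp_mul_Ioi (by simpa using hx) z
  have hint : IntegrableOn (fun s => x * Real.exp (-s * x)) (Ioi z) := by
    refine (Integrable.const_mul hi x).congr (Eventually.of_forall fun s => ?_)
    simp [mul_comm]
  rw [← ofReal_integral_eq_lintegral_ofReal hint (Eventually.of_forall fun s => by positivity)]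
  congr 1
  have := integral_exp_mul_Ioi (a := -x) (by simpa using hx) z
  rw [integral_const_mul]
  have h2 : ∀ s, Real.exp (-s * x) = Real.exp (-x * s) := fun s => by ring_nf
  simp_rw [h2, this]
  field_simp

lemma measurable_laplaceDeriv_kernel : Measurable fun p : ℝ × PosReal =>
    ENNReal.ofReal ((p.2 : ℝ) * Real.exp (-p.1 * (p.2 : ℝ))) := by fun_prop

/-- Tonelli. It translates statements about the test functions `e^{-zx} - e^{-wx}` into statements
about the measure with density `laplaceDeriv ν`. -/
lemma setLIntegral_laplaceDeriv_Ioc (ν : Measure PosReal) [SFinite ν] {z w : ℝ} (hzw : z ≤ w) :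
    ∫⁻ s in Ioc z w, laplaceDeriv ν s
      = ∫⁻ x : PosReal, ENNReal.ofReal (Real.exp (-z * (x : ℝ)) - Real.exp (-w * (x : ℝ))) ∂ν := by
  unfold laplaceDeriv
  rw [lintegral_lintegral_swap measurable_laplaceDeriv_kernel.aemeasurable]
  exact lintegral_congr fun x => setLIntegral_Ioc_mul_exp x.2 hzw

lemma setLIntegral_laplaceDeriv_Ioi (ν : Measure PosReal) [SFinite ν] (z : ℝ) :
    ∫⁻ s in Ioi z, laplaceDeriv ν s
      = ∫⁻ x : PosReal, ENNReal.ofReal (Real.exp (-z * (x : ℝ))) ∂ν := by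
  unfold laplaceDeriv
  rw [lintegral_lintegral_swap measurable_laplaceDeriv_kernel.aemeasurable]
  exact lintegral_congr fun x => setLIntegral_Ioi_mul_exp x.2

lemma integrable_mul_exp_of_laplaceDeriv_ne_top {ν : Measure PosReal} {z : ℝ}
    (h : laplaceDeriv ν z ≠ ∞) :
    Integrable (fun x : PosReal => (x : ℝ) * Real.exp (-z * (x : ℝ))) ν := by
  refine ⟨by fun_prop, ?_⟩
  rw [hasFiniteIntegral_iff_ofReal
    (Eventually.of_forall fun x => mul_nonneg (le_of_lt x.2) (Real.exp_pos _).le)]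
  exact h.lt_top

lemma toReal_laplaceDeriv (ν : Measure PosReal) (z : ℝ) :
    (laplaceDeriv ν z).toReal = ∫ x : PosReal, (x : ℝ) * Real.exp (-z * (x : ℝ)) ∂ν := by
  rw [integral_eq_lintegral_of_nonneg_ae
    (Eventually.of_forall fun x => mul_nonneg (le_of_lt x.2) (Real.exp_pos _).le) (by fun_prop)]
  rfl

lemma continuousOn_toReal_laplaceDeriv {ν : Measure PosReal}
    (h : ∀ z : ℝ, 0 < z → laplaceDeriv ν z ≠ ∞) :
    ContinuousOn (fun z => (laplaceDeriv ν z).toReal) (Ioi 0) := by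
  intro z hz
  have hz' : (0 : ℝ) < z := hz
  refine ContinuousAt.continuousWithinAt ?_
  simp_rw [toReal_laplaceDeriv]
  refine continuousAt_of_dominated (bound := fun x : PosReal => (x : ℝ) * Real.exp (-(z / 2) * (x : ℝ)))
    (Eventually.of_forall fun w => by fun_prop) ?_
    (integrable_mul_exp_of_laplaceDeriv_ne_top (h _ (by positivity)))
    (Eventually.of_forall fun x => by fun_prop)
  filter_upwards [lt_mem_nhds (half_lt_self hz')] with w hw
  refine Eventually.of_forall fun x => ?_
  have hx : 0 < (x : ℝ) := x.2
  rw [Real.norm_of_nonneg (by positivity)]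
  gcongr

lemma setLIntegral_laplaceDeriv_eq_ofReal {ν : Measure PosReal}
    (h : ∀ z : ℝ, 0 < z → laplaceDeriv ν z ≠ ∞) {z w : ℝ} (hz : 0 < z) (hzw : z ≤ w) :
    ∫⁻ s in Ioc z w, laplaceDeriv ν s
      = ENNReal.ofReal (∫ s in z..w, (laplaceDeriv ν s).toReal) := by
  have hint : IntervalIntegrable (fun s => (laplaceDeriv ν s).toReal) volume z w := by
    refine ((continuousOn_toReal_laplaceDeriv h).mono ?_).intervalIntegrable
    rw [uIcc_of_le hzw]
    exact fun s hs => lt_of_lt_of_le hz hs.1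
  rw [intervalIntegral.integral_of_le hzw, ofReal_integral_eq_lintegral_ofReal
    ((intervalIntegrable_iff_integrableOn_Ioc_of_le hzw).1 hint)
    (Eventually.of_forall fun s => ENNReal.toReal_nonneg)]
  refine setLIntegral_congr_fun measurableSet_Ioc fun s hs => ?_
  exact (ENNReal.ofReal_toReal (h s (hz.trans hs.1))).symm

/-- A measure on `(0, ∞)` is determined by the derivative of its Laplace transform. -/
lemma eq_of_laplaceDeriv_eq {ν₁ ν₂ : Measure PosReal}
    (hfin : ∀ z : ℝ, 0 < z → laplaceDeriv ν₁ z ≠ ∞)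
    (h : ∀ z : ℝ, 0 < z → laplaceDeriv ν₁ z = laplaceDeriv ν₂ z) : ν₁ = ν₂ := by
  -- `laplaceDeriv ν` is the ordinary Laplace transform of `x ν(dx)`, and the weight `x` is
  -- invertible on `(0, ∞)`.
  set f : PosReal → ℝ≥0∞ := fun x => ENNReal.ofReal (x : ℝ) with hf
  have hfm : Measurable f := by fun_prop
  have hne : ∀ x, f x ≠ 0 := fun x => (ENNReal.ofReal_pos.2 x.2).ne'
  have hnt : ∀ x, f x ≠ ∞ := fun x => by simp [hf]
  have hlap : ∀ (ν : Measure PosReal) (z : ℝ),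
      ∫⁻ x, ENNReal.ofReal (Real.exp (-z * (x : ℝ))) ∂(ν.withDensity f) = laplaceDeriv ν z := by
    intro ν z
    rw [lintegral_withDensity_eq_lintegral_mul _ hfm (by fun_prop)]
    refine lintegral_congr fun x => ?_
    rw [ENNReal.ofReal_mul (le_of_lt x.2)]
    rfl
  have key : ν₁.withDensity f = ν₂.withDensity f := by
    refine measure_posReal_ext_of_lintegral_exp_neg (fun z hz => ?_) (fun z hz => ?_)
    · rw [hlap]; exact hfin z hz
    · rw [hlap, hlap]; exact h z hz
  rw [← withDensity_inv_same (μ := ν₁) hfm (Eventually.of_forall hne) (Eventually.of_forall hnt),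
    key, withDensity_inv_same hfm (Eventually.of_forall hne) (Eventually.of_forall hnt)]

/-! ### The measure `(W(x)/x) dx`. -/

section Scale

variable {Ψ : BranchingMechanism} {W : ℝ → ℝ}

lemma scaleFunction_pos (hW : Ψ.IsScaleFunction W) {x : ℝ} (hx : 0 < x) : 0 < W x :=
  (hW.nonneg 0 le_rfl).trans_lt (hW.strictMonoOn self_mem_Ici hx.le hx)

/-- The factor `x` cancels the `1/x` of the density and leaves the Laplace transform of `W`. -/
lemma laplaceDeriv_scaleMeasure (hW : Ψ.IsScaleFunction W) {z : ℝ} (hz : 0 < z) :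
    laplaceDeriv (scaleMeasure W) z = ENNReal.ofReal (1 / Ψ.psi z) := by
  have hWm : Measurable fun x : PosReal => W (x : ℝ) :=
    (continuousOn_iff_continuous_domRestrict.1
      (hW.continuousOn.mono Ioi_subset_Ici_self)).measurable
  have hdens : Measurable fun x : PosReal => ENNReal.ofReal (W (x : ℝ) / (x : ℝ)) :=
    (hWm.div measurable_subtype_coe).ennreal_ofReal
  rw [← hW.laplace z hz, ofReal_integral_eq_lintegral_ofReal (hW.integrableOn z hz)
    ((ae_restrict_iff' measurableSet_Ioi).2 (Eventually.of_forall fun x hx =>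
      mul_nonneg (Real.exp_pos _).le (hW.nonneg x (le_of_lt hx))))]
  rw [laplaceDeriv, scaleMeasure, lintegral_withDensity_eq_lintegral_mul _
    hdens (by fun_prop), ← lintegral_subtype_comap measurableSet_Ioi]
  refine lintegral_congr fun x => ?_
  have hx : 0 < (x : ℝ) := x.2
  rw [Pi.mul_apply, ← ENNReal.ofReal_mul (div_nonneg (hW.nonneg _ hx.le) hx.le)]
  congr 1
  field_simp

/-- Read off from `W`: `1/ψ(z)` is the integral of a function that is positive on `(0, ∞)`. -/
lemma psi_pos (hW : Ψ.IsScaleFunction W) {z : ℝ} (hz : 0 < z) : 0 < Ψ.psi z := by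
  have h : 0 < ∫ x in Ioi (0 : ℝ), Real.exp (-z * x) * W x := by
    rw [setIntegral_pos_iff_support_of_nonneg_ae
      ((ae_restrict_iff' measurableSet_Ioi).2 (Eventually.of_forall fun x hx =>
      mul_nonneg (Real.exp_pos _).le (hW.nonneg x (le_of_lt hx)))) (hW.integrableOn z hz)]
    have : Ioi (0 : ℝ) ⊆ Function.support (fun x => Real.exp (-z * x) * W x) :=
      fun x hx => (mul_pos (Real.exp_pos _) (scaleFunction_pos hW hx)).ne'
    rw [inter_eq_self_of_subset_right this]
    simp
  rw [hW.laplace z hz] at h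
  exact one_div_pos.1 h

lemma laplaceDeriv_scaleMeasure_ne_top (hW : Ψ.IsScaleFunction W) (z : ℝ) (hz : 0 < z) :
    laplaceDeriv (scaleMeasure W) z ≠ ∞ := by
  rw [laplaceDeriv_scaleMeasure hW hz]; exact ENNReal.ofReal_ne_top

lemma toReal_laplaceDeriv_scaleMeasure (hW : Ψ.IsScaleFunction W) {z : ℝ} (hz : 0 < z) :
    (laplaceDeriv (scaleMeasure W) z).toReal = 1 / Ψ.psi z := by
  rw [laplaceDeriv_scaleMeasure hW hz,
    ENNReal.toReal_ofReal (one_div_nonneg.2 (psi_pos hW hz).le)]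

lemma continuousOn_one_div_psi (hW : Ψ.IsScaleFunction W) :
    ContinuousOn (fun z => 1 / Ψ.psi z) (Ioi 0) :=
  (continuousOn_toReal_laplaceDeriv (laplaceDeriv_scaleMeasure_ne_top hW)).congr
    fun _ hz => (toReal_laplaceDeriv_scaleMeasure hW hz).symm

lemma sFinite_scaleMeasure (W : ℝ → ℝ) : SFinite (scaleMeasure W) := by
  have : SFinite (Measure.comap ((↑) : PosReal → ℝ) volume) := by
    have := isOpen_Ioi.locallyCompactSpace (X := ℝ) (s := Ioi 0)
    have : IsFiniteMeasureOnCompacts (Measure.comap ((↑) : PosReal → ℝ) volume) :=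
      .comap' _ continuous_subtype_val (MeasurableEmbedding.subtype_coe measurableSet_Ioi)
    infer_instance
  unfold scaleMeasure
  infer_instance

/-- The integral equals `∫_z^∞ ds/ψ(s)`; the part beyond `c` is finite by hypothesis, the bounded
part by continuity of `1/ψ` on `(0, ∞)`. -/
lemma lintegral_exp_scaleMeasure_ne_top (hψ : Ψ.IntegralInvFinite) (hW : Ψ.IsScaleFunction W)
    {z : ℝ} (hz : 0 < z) :
    ∫⁻ x : PosReal, ENNReal.ofReal (Real.exp (-z * (x : ℝ))) ∂(scaleMeasure W) ≠ ∞ := by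
  have := sFinite_scaleMeasure W
  obtain ⟨c, hc, hfin⟩ := hψ
  rw [← setLIntegral_laplaceDeriv_Ioi]
  have h1 : ∫⁻ s in Ioi c, laplaceDeriv (scaleMeasure W) s < ∞ := by
    refine lt_of_eq_of_lt (setLIntegral_congr_fun measurableSet_Ioi fun s hs => ?_) hfin
    have hs0 : 0 < s := hc.trans hs
    rw [laplaceDeriv_scaleMeasure hW hs0, one_div, ENNReal.ofReal_inv_of_pos (psi_pos hW hs0)]
  refine ne_top_of_le_ne_top ?_ (lintegral_mono_set
    (show Ioi z ⊆ Ioc z (max z c) ∪ Ioi c from fun s hs => ?_))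
  · refine ne_top_of_le_ne_top ?_ (lintegral_union_le _ _ _)
    refine ENNReal.add_ne_top.2 ⟨?_, h1.ne⟩
    rw [setLIntegral_laplaceDeriv_eq_ofReal (laplaceDeriv_scaleMeasure_ne_top hW) hz
      (le_max_left _ _)]
    exact ENNReal.ofReal_ne_top
  · by_cases h : s ≤ c
    · exact Or.inl ⟨hs, h.trans (le_max_right _ _)⟩
    · exact Or.inr (not_le.1 h)

lemma scaleMeasure_ne_zero (hW : Ψ.IsScaleFunction W) : scaleMeasure W ≠ 0 := by
  intro h0
  have := laplaceDeriv_scaleMeasure hW one_pos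
  rw [h0, laplaceDeriv, lintegral_zero_measure] at this
  have h1 := ENNReal.ofReal_eq_zero.1 this.symm
  exact absurd h1 (not_le.2 (one_div_pos.2 (psi_pos hW one_pos)))

lemma isLocallyFiniteMeasure_scaleMeasure (hψ : Ψ.IntegralInvFinite) (hW : Ψ.IsScaleFunction W) :
    IsLocallyFiniteMeasure (scaleMeasure W) := by
  refine ⟨fun x => ⟨{y | (y : ℝ) < x + 1},
    (isOpen_Iio.preimage continuous_subtype_val).mem_nhds (by simp), ?_⟩⟩
  have hfin := lintegral_exp_scaleMeasure_ne_top hψ hW one_pos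
  -- Markov's inequality for `e^{-y}`, which is at least `e^{-(x+1)}` on the chosen neighbourhood.
  refine lt_of_le_of_lt ((measure_mono ?_).trans (meas_ge_le_lintegral_div (by fun_prop)
    (ε := ENNReal.ofReal (Real.exp (-((x : ℝ) + 1)))) (by simp [Real.exp_pos]) (by simp)))
    (ENNReal.div_lt_top hfin (by simp [Real.exp_pos]))
  intro y hy
  have hy' : (y : ℝ) < x + 1 := hy
  refine ENNReal.ofReal_le_ofReal (Real.exp_le_exp.2 ?_)
  linarith

end Scale

/-! ### A linear bound for `ψ` on bounded intervals. -/

lemma exp_neg_sub_one_add_nonneg (y : ℝ) : 0 ≤ Real.exp (-y) - 1 + y := by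
  linarith [Real.add_one_le_exp (-y)]

lemma exp_neg_sub_one_add_le_min {y : ℝ} (hy : 0 ≤ y) :
    Real.exp (-y) - 1 + y ≤ min y (y ^ 2) := by
  have h1 : Real.exp (-y) ≤ 1 := Real.exp_le_one_iff.2 (by linarith)
  refine le_min (by linarith) ?_
  rcases le_total y 1 with h | h
  · have := (abs_le.1 (Real.abs_exp_sub_one_sub_id_le (x := -y)
      (by rwa [abs_neg, abs_of_nonneg hy]))).2
    linarith [neg_sq y]
  · nlinarith

namespace BranchingMechanism

lemma psi_zero (Ψ : BranchingMechanism) : Ψ.psi 0 = 0 := by simp [psi]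

/-- For `s ≤ b` the Lévy integrand is at most `min (sr) (s²r²) ≤ s(1+b) min r r²`. The linear bound
prevents the cumulant from reaching `0` in finite time. -/
lemma exists_psi_le_mul (Ψ : BranchingMechanism) {b : ℝ} (hb : 0 ≤ b) :
    ∃ C : ℝ, ∀ s ∈ Icc 0 b, Ψ.psi s ≤ C * s := by
  have hint : Integrable (fun r : PosReal => min (r : ℝ) ((r : ℝ) ^ 2)) Ψ.π := by
    refine ⟨(by fun_prop : Measurable fun r : PosReal =>
      min (r : ℝ) ((r : ℝ) ^ 2)).aestronglyMeasurable, ?_⟩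
    rw [hasFiniteIntegral_iff_ofReal
      (Eventually.of_forall fun r => le_min (le_of_lt r.2) (sq_nonneg _))]
    exact Ψ.lintegral_min_lt_top
  set m := ∫ r : PosReal, min (r : ℝ) ((r : ℝ) ^ 2) ∂Ψ.π with hm
  refine ⟨Ψ.α + 1 / 2 * Ψ.σ ^ 2 * b + (1 + b) * m, fun s hs => ?_⟩
  obtain ⟨hs0, hsb⟩ := hs
  have h1 : ∫ r : PosReal, (Real.exp (-s * (r : ℝ)) - 1 + s * (r : ℝ)) ∂Ψ.π
      ≤ ∫ r : PosReal, (s * (1 + b)) * min (r : ℝ) ((r : ℝ) ^ 2) ∂Ψ.π := by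
    refine integral_mono_of_nonneg (Eventually.of_forall fun r => ?_) (hint.const_mul _)
      (Eventually.of_forall fun r => ?_)
    · have := exp_neg_sub_one_add_nonneg (s * (r : ℝ))
      simpa [neg_mul] using this
    · have hr : 0 < (r : ℝ) := r.2
      have h := exp_neg_sub_one_add_le_min (mul_nonneg hs0 hr.le)
      simp only [neg_mul]
      refine h.trans ?_
      rw [mul_min_of_nonneg _ _ (by positivity)]
      refine min_le_min ?_ ?_
      · have : 0 ≤ s * b * (r : ℝ) := by positivity
        nlinarith
      · have h2 : s * s ≤ s * b := by gcongr
        have h3 : 0 ≤ (r : ℝ) ^ 2 := sq_nonneg _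
        nlinarith [mul_nonneg hs0 h3, mul_le_mul_of_nonneg_right h2 h3]
  rw [integral_const_mul, ← hm] at h1
  have h2 : 1 / 2 * Ψ.σ ^ 2 * s ^ 2 ≤ 1 / 2 * Ψ.σ ^ 2 * (s * b) := by
    rw [sq s]; gcongr
  unfold psi
  linarith

end BranchingMechanism

/-! ### The flow of `u' = -ψ(u)`. -/

section Cumulant

variable {Ψ : BranchingMechanism} {W : ℝ → ℝ} {u : ℝ → ℝ → ℝ}

lemma psi_nonneg (hW : Ψ.IsScaleFunction W) {z : ℝ} (hz : 0 ≤ z) : 0 ≤ Ψ.psi z := by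
  rcases hz.eq_or_lt with rfl | hz
  · rw [Ψ.psi_zero]
  · exact (psi_pos hW hz).le

lemma cumulant_antitoneOn (hW : Ψ.IsScaleFunction W) (hu : Ψ.IsCumulant u) {z : ℝ} (hz : 0 < z) :
    AntitoneOn (fun t => u t z) (Ici 0) := by
  have hder : ∀ t ∈ interior (Ici (0 : ℝ)),
      HasDerivAt (fun s => u s z) (-Ψ.psi (u t z)) t := by
    intro t ht
    rw [interior_Ici] at ht
    exact ((hu z hz).2 t (le_of_lt ht)).2.hasDerivAt (Ici_mem_nhds ht)
  refine antitoneOn_of_deriv_nonpos (convex_Ici 0)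
    (fun t ht => ((hu z hz).2 t ht).2.continuousWithinAt)
    (fun t ht => (hder t ht).differentiableAt.differentiableWithinAt) fun t ht => ?_
  rw [(hder t ht).deriv, neg_nonpos]
  exact psi_nonneg hW ((hu z hz).2 t (interior_subset ht)).1

lemma cumulant_le (hW : Ψ.IsScaleFunction W) (hu : Ψ.IsCumulant u) {z t : ℝ} (hz : 0 < z)
    (ht : 0 ≤ t) : u t z ≤ z := by
  have := cumulant_antitoneOn hW hu hz self_mem_Ici ht ht
  simpa [(hu z hz).1] using this

/-- Grönwall: the cumulant stays in `[0, z]`, where `ψ(s) ≤ Cs`, so `u_t(z) e^{Ct}` is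
nondecreasing. -/
lemma cumulant_pos (hW : Ψ.IsScaleFunction W) (hu : Ψ.IsCumulant u) {z t : ℝ} (hz : 0 < z)
    (ht : 0 ≤ t) : 0 < u t z := by
  obtain ⟨C, hC⟩ := Ψ.exists_psi_le_mul hz.le
  have hder : ∀ s ∈ Ici (0 : ℝ), HasDerivWithinAt (fun s => u s z * Real.exp (C * s))
      (-Ψ.psi (u s z) * Real.exp (C * s) + u s z * (Real.exp (C * s) * C)) (Ici 0) s := by
    intro s hs
    have h2 : HasDerivWithinAt (fun s => Real.exp (C * s)) (Real.exp (C * s) * C) (Ici 0) s := by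
      simpa using (((hasDerivAt_id s).const_mul C).exp).hasDerivWithinAt
    exact ((hu z hz).2 s hs).2.mul h2
  have hmono : MonotoneOn (fun s => u s z * Real.exp (C * s)) (Ici 0) := by
    have hder' : ∀ s ∈ interior (Ici (0 : ℝ)), HasDerivAt (fun s => u s z * Real.exp (C * s))
        (-Ψ.psi (u s z) * Real.exp (C * s) + u s z * (Real.exp (C * s) * C)) s := by
      intro s hs
      rw [interior_Ici] at hs
      exact (hder s (le_of_lt (mem_Ioi.1 hs) : (0 : ℝ) ≤ s)).hasDerivAt (Ici_mem_nhds hs)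
    refine monotoneOn_of_deriv_nonneg (convex_Ici 0)
      (fun s hs => (hder s hs).continuousWithinAt)
      (fun s hs => (hder' s hs).differentiableAt.differentiableWithinAt) fun s hs => ?_
    rw [(hder' s hs).deriv]
    have hs0 : 0 ≤ s := interior_subset hs
    have := hC (u s z) ⟨((hu z hz).2 s hs0).1, cumulant_le hW hu hz hs0⟩
    nlinarith [Real.exp_pos (C * s)]
  have h := hmono self_mem_Ici ht ht
  simp only [(hu z hz).1, mul_zero, Real.exp_zero, mul_one] at h
  exact pos_of_mul_pos_left (hz.trans_le h) (Real.exp_pos _).le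

/-- The primitive of a function continuous on `(0, ∞)` is differentiable there. -/
lemma hasDerivAt_integral_of_continuousOn_Ioi {h : ℝ → ℝ} (hc : ContinuousOn h (Ioi 0)) {a y : ℝ}
    (ha : 0 < a) (hy : 0 < y) : HasDerivAt (fun y => ∫ s in a..y, h s) (h y) y := by
  refine intervalIntegral.integral_hasDerivAt_right ?_ ?_ (hc.continuousAt (Ioi_mem_nhds hy))
  · refine (hc.mono fun s hs => ?_).intervalIntegrable
    exact lt_of_lt_of_le (lt_min ha hy) hs.1
  · exact hc.stronglyMeasurableAtFilter isOpen_Ioi y hy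

lemma intervalIntegrable_of_continuousOn_Ioi {h : ℝ → ℝ} (hc : ContinuousOn h (Ioi 0)) {a b : ℝ}
    (ha : 0 < a) (hb : 0 < b) : IntervalIntegrable h volume a b :=
  (hc.mono fun _ hs => lt_of_lt_of_le (lt_min ha hb) hs.1).intervalIntegrable

/-- The time for the cumulant to move from `z` to `u t z`. -/
lemma integral_one_div_psi_cumulant (hW : Ψ.IsScaleFunction W) (hu : Ψ.IsCumulant u) {z t : ℝ}
    (hz : 0 < z) (ht : 0 ≤ t) : ∫ s in u t z..z, 1 / Ψ.psi s = t := by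
  have hc := continuousOn_one_div_psi hW
  -- Separation of variables, `du/ψ(u) = -dt`, written as a function with vanishing right
  -- derivative.
  have hder : ∀ r : ℝ, 0 ≤ r → HasDerivWithinAt
      (fun r => (∫ s in z..u r z, 1 / Ψ.psi s) + r) 0 (Ici 0) r := by
    intro r hr
    have hp := cumulant_pos hW hu hz hr
    have h1 := (hasDerivAt_integral_of_continuousOn_Ioi hc hz hp).comp_hasDerivWithinAt r
      ((hu z hz).2 r hr).2
    refine (h1.add (hasDerivWithinAt_id r _)).congr_deriv ?_
    have := (psi_pos hW hp).ne'
    field_simp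
    ring
  have h := constant_of_has_deriv_right_zero (a := 0) (b := t)
    (fun r hr => ((hder r hr.1).continuousWithinAt.mono Icc_subset_Ici_self))
    (fun r hr => (hder r hr.1).mono (Ici_subset_Ici.2 hr.1)) t ⟨ht, le_rfl⟩
  simp only [(hu z hz).1, intervalIntegral.integral_same, add_zero] at h
  rw [intervalIntegral.integral_symm]
  linarith

/-- Both endpoints travel for the same time `t`, so their contributions cancel. This is the
stationarity of `scaleMeasure W` in Laplace form. -/
lemma integral_one_div_psi_cumulant_cumulant (hW : Ψ.IsScaleFunction W) (hu : Ψ.IsCumulant u)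
    {z w t : ℝ} (hz : 0 < z) (hw : 0 < w) (ht : 0 ≤ t) :
    ∫ s in u t z..u t w, 1 / Ψ.psi s = ∫ s in z..w, 1 / Ψ.psi s := by
  have hc := continuousOn_one_div_psi hW
  have h1 := integral_one_div_psi_cumulant hW hu hz ht
  have h2 := integral_one_div_psi_cumulant hW hu hw ht
  have pz := cumulant_pos hW hu hz ht
  have pw := cumulant_pos hW hu hw ht
  have e1 := intervalIntegral.integral_add_adjacent_intervals
    (intervalIntegrable_of_continuousOn_Ioi hc pz hz)
    (intervalIntegrable_of_continuousOn_Ioi hc hz hw)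
  have e2 := intervalIntegral.integral_add_adjacent_intervals
    (intervalIntegrable_of_continuousOn_Ioi hc pz pw)
    (intervalIntegrable_of_continuousOn_Ioi hc pw hw)
  linarith

lemma integral_one_div_psi_pos (hW : Ψ.IsScaleFunction W) {z w : ℝ} (hz : 0 < z) (hzw : z < w) :
    0 < ∫ s in z..w, 1 / Ψ.psi s :=
  intervalIntegral.intervalIntegral_pos_of_pos_on
    (intervalIntegrable_of_continuousOn_Ioi (continuousOn_one_div_psi hW) hz (hz.trans hzw))
    (fun _ hs => one_div_pos.2 (psi_pos hW (hz.trans hs.1))) hzw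

/-- The flow preserves `∫_z^w ds/ψ(s)`, hence its sign, hence the order of the endpoints. -/
lemma cumulant_strictMonoOn (hW : Ψ.IsScaleFunction W) (hu : Ψ.IsCumulant u) {t : ℝ}
    (ht : 0 ≤ t) : StrictMonoOn (u t) (Ioi 0) := by
  intro z hz w hw hzw
  by_contra hle
  have h1 := integral_one_div_psi_pos hW hz hzw
  rw [← integral_one_div_psi_cumulant_cumulant hW hu hz hw ht,
    intervalIntegral.integral_symm] at h1
  have h2 : 0 ≤ ∫ s in u t w..u t z, 1 / Ψ.psi s :=
    intervalIntegral.integral_nonneg (not_lt.1 hle) fun s hs =>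
      one_div_nonneg.2 (psi_nonneg hW ((cumulant_pos hW hu hw ht).le.trans hs.1))
  linarith

/-- Coming down from infinity: at a large time the cumulant is uniformly small. -/
lemma exists_cumulant_le (hψ : Ψ.IntegralInvFinite) (hW : Ψ.IsScaleFunction W)
    (hu : Ψ.IsCumulant u) {v : ℝ} (hv : 0 < v) :
    ∃ t : ℝ≥0, 0 < t ∧ ∀ w : ℝ, 0 < w → u t w ≤ v := by
  have := sFinite_scaleMeasure W
  -- `G = ∫_v^∞ ds/ψ(s)` bounds the travel time down to `v` from every starting point, so at time `G
  -- + 1` the cumulant cannot still be above `v`.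
  set G := (∫⁻ x : PosReal, ENNReal.ofReal (Real.exp (-v * (x : ℝ))) ∂(scaleMeasure W)).toReal
    with hG
  have hG0 : 0 ≤ G := ENNReal.toReal_nonneg
  refine ⟨⟨G + 1, by positivity⟩, NNReal.coe_pos.1 (show (0 : ℝ) < G + 1 by positivity), fun w hw => ?_⟩
  by_contra! hlt
  have ht : 0 ≤ G + 1 := by positivity
  have hlt' : v < u (G + 1) w := hlt
  have hle := cumulant_le hW hu hw ht
  have hvw : v ≤ w := hlt'.le.trans hle
  have h1 := integral_one_div_psi_cumulant hW hu hw ht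
  have h2 : ∫ s in u (G + 1) w..w, 1 / Ψ.psi s ≤ ∫ s in v..w, 1 / Ψ.psi s := by
    refine intervalIntegral.integral_mono_interval hlt'.le hle le_rfl ?_
      (intervalIntegrable_of_continuousOn_Ioi (continuousOn_one_div_psi hW) hv hw)
    exact (ae_restrict_iff' measurableSet_Ioc).2 (Eventually.of_forall fun s hs =>
      one_div_nonneg.2 (psi_pos hW (hv.trans hs.1)).le)
  have h3 : ∫ s in v..w, 1 / Ψ.psi s ≤ G := by
    rw [hG, ← ENNReal.ofReal_le_iff_le_toReal (lintegral_exp_scaleMeasure_ne_top hψ hW hv),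
      ← setLIntegral_laplaceDeriv_Ioi]
    refine le_trans (le_of_eq ?_) (lintegral_mono_set (show Ioc v w ⊆ Ioi v from Ioc_subset_Ioi_self))
    rw [setLIntegral_laplaceDeriv_eq_ofReal (laplaceDeriv_scaleMeasure_ne_top hW) hv hvw]
    congr 1
    refine intervalIntegral.integral_congr fun s hs => ?_
    rw [uIcc_of_le hvw] at hs
    exact (toReal_laplaceDeriv_scaleMeasure hW (hv.trans_le hs.1)).symm
  linarith

end Cumulant

/-! ### The kernel on `(0, ∞)` and stationarity of the scale measure. -/

variable {Ψ : BranchingMechanism} {W : ℝ → ℝ} {u : ℝ → ℝ → ℝ} {Ω : Type*} [MeasurableSpace Ω]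
  {P : PosReal → Measure Ω} {Z : ℝ≥0 → Ω → ℝ}

/-- The law of `Z t` under `P x`, restricted to `(0, ∞)`. -/
noncomputable def posLaw (P : PosReal → Measure Ω) (Z : ℝ≥0 → Ω → ℝ) (t : ℝ≥0) (x : PosReal) :
    Measure PosReal :=
  ((P x).map (Z t)).comap ((↑) : PosReal → ℝ)

lemma posLaw_apply (hZ : IsCBProcess Ψ P Z) (t : ℝ≥0) (x : PosReal) {A : Set PosReal}
    (hA : MeasurableSet A) :
    posLaw P Z t x A = P x {ω | Z t ω ∈ ((↑) : PosReal → ℝ) '' A} := by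
  have hemb : MeasurableEmbedding ((↑) : PosReal → ℝ) :=
    MeasurableEmbedding.subtype_coe measurableSet_Ioi
  rw [posLaw, hemb.comap_apply, Measure.map_apply (hZ.measurable t).measurable
    (hemb.measurableSet_image.2 hA)]
  rfl

lemma measurable_posLaw (hZ : IsCBProcess Ψ P Z) (t : ℝ≥0) : Measurable (posLaw P Z t) := by
  have hemb : MeasurableEmbedding ((↑) : PosReal → ℝ) :=
    MeasurableEmbedding.subtype_coe measurableSet_Ioi
  refine Measure.measurable_of_measurable_coe _ fun A hA => ?_
  have h := (hZ.measurable_transition t _ (hemb.measurableSet_image.2 hA)).comp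
    (measurable_subtype_coe (p := fun y : ℝ => y ∈ Ioi (0 : ℝ)))
  convert h using 1
  funext x
  have hx : 0 < (x : ℝ) := x.2
  simp only [Function.comp, transition, dif_pos hx, posLaw_apply hZ t x hA]
  rfl

lemma lintegral_posLaw (hZ : IsCBProcess Ψ P Z) (t : ℝ≥0) (x : PosReal) {f : ℝ → ℝ≥0∞}
    (hf : Measurable f) (hf0 : f 0 = 0) :
    ∫⁻ y : PosReal, f y ∂(posLaw P Z t x) = ∫⁻ ω, f (Z t ω) ∂(P x) := by
  rw [posLaw, lintegral_subtype_comap measurableSet_Ioi, ← lintegral_indicator measurableSet_Ioi,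
    lintegral_map (hf.indicator measurableSet_Ioi) (hZ.measurable t).measurable]
  refine lintegral_congr fun ω => ?_
  rcases (hZ.nonneg t ω).eq_or_lt with h | h
  · rw [← h, hf0]; simp
  · exact indicator_of_mem (s := Ioi (0 : ℝ)) h f

lemma isStationaryMeasure_iff (hZ : IsCBProcess Ψ P Z) (ν : Measure PosReal) :
    IsStationaryMeasure P Z ν ↔
      IsLocallyFiniteMeasure ν ∧ ∀ t : ℝ≥0, 0 < t → ν.bind (posLaw P Z t) = ν := by
  have key : ∀ (t : ℝ≥0) (A : Set PosReal), MeasurableSet A → ν.bind (posLaw P Z t) A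
      = ∫⁻ x, P x {ω | Z t ω ∈ ((↑) : PosReal → ℝ) '' A} ∂ν := fun t A hA => by
    rw [Measure.bind_apply hA (measurable_posLaw hZ t).aemeasurable]
    exact lintegral_congr fun x => posLaw_apply hZ t x hA
  refine ⟨fun h => ⟨h.1, fun t ht => Measure.ext fun A hA => ?_⟩,
    fun h => ⟨h.1, fun t ht A hA => ?_⟩⟩
  · rw [key t A hA, h.2 t ht A hA]
  · rw [← key t A hA, h.2 t ht]

lemma integrable_exp_neg_mul (hZ : IsCBProcess Ψ P Z) (x : PosReal) (t : ℝ≥0) {z : ℝ}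
    (hz : 0 ≤ z) : Integrable (fun ω => Real.exp (-z * Z t ω)) (P x) := by
  have := hZ.isProbabilityMeasure x
  have hm := (hZ.measurable t).measurable
  refine Integrable.of_bound (by fun_prop) 1 (Eventually.of_forall fun ω => ?_)
  rw [Real.norm_of_nonneg (Real.exp_pos _).le, Real.exp_le_one_iff]
  nlinarith [hZ.nonneg t ω]

lemma lintegral_exp_sub_exp (hZ : IsCBProcess Ψ P Z) (x : PosReal) (t : ℝ≥0)
    (hu : ∀ (x : PosReal) (t : ℝ≥0) (z : ℝ), 0 < z →
      ∫ ω, Real.exp (-z * Z t ω) ∂(P x) = Real.exp (-(x : ℝ) * u (t : ℝ) z))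
    {z w : ℝ} (hz : 0 < z) (hzw : z ≤ w) :
    ∫⁻ ω, ENNReal.ofReal (Real.exp (-z * Z t ω) - Real.exp (-w * Z t ω)) ∂(P x)
      = ENNReal.ofReal (Real.exp (-u t z * (x : ℝ)) - Real.exp (-u t w * (x : ℝ))) := by
  have iz := integrable_exp_neg_mul hZ x t hz.le
  have iw := integrable_exp_neg_mul hZ x t (hz.le.trans hzw)
  have hsub : Integrable (fun ω => Real.exp (-z * Z t ω) - Real.exp (-w * Z t ω)) (P x) :=
    iz.sub iw
  rw [← ofReal_integral_eq_lintegral_ofReal hsub, integral_sub iz iw, hu x t z hz,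
    hu x t w (hz.trans_le hzw)]
  · ring_nf
  · refine Eventually.of_forall fun ω => sub_nonneg.2 (Real.exp_le_exp.2 ?_)
    nlinarith [hZ.nonneg t ω]

/-- `posLaw` discards the mass at `0`, which is harmless because the difference of exponentials
vanishes there; the kernel then acts only by moving the parameters along the flow. -/
lemma lintegral_bind_posLaw_exp_sub_exp (hZ : IsCBProcess Ψ P Z) (t : ℝ≥0)
    (hu : ∀ (x : PosReal) (t : ℝ≥0) (z : ℝ), 0 < z →
      ∫ ω, Real.exp (-z * Z t ω) ∂(P x) = Real.exp (-(x : ℝ) * u (t : ℝ) z))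
    {z w : ℝ} (hz : 0 < z) (hzw : z ≤ w) (ν : Measure PosReal) :
    ∫⁻ y : PosReal, ENNReal.ofReal (Real.exp (-z * (y : ℝ)) - Real.exp (-w * (y : ℝ)))
        ∂(ν.bind (posLaw P Z t))
      = ∫⁻ x : PosReal,
          ENNReal.ofReal (Real.exp (-u t z * (x : ℝ)) - Real.exp (-u t w * (x : ℝ))) ∂ν := by
  rw [Measure.lintegral_bind (measurable_posLaw hZ t).aemeasurable (by fun_prop)]
  refine lintegral_congr fun x => ?_
  rw [← lintegral_exp_sub_exp hZ x t hu hz hzw]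
  exact lintegral_posLaw hZ t x
    (f := fun y => ENNReal.ofReal (Real.exp (-z * y) - Real.exp (-w * y)))
    (by fun_prop) (by simp)

lemma tendsto_lintegral_exp_sub_exp (m : Measure PosReal) (z : ℝ) :
    Tendsto (fun n : ℕ => ∫⁻ x : PosReal,
        ENNReal.ofReal (Real.exp (-z * (x : ℝ)) - Real.exp (-(z + n) * (x : ℝ))) ∂m) atTop
      (𝓝 (∫⁻ x : PosReal, ENNReal.ofReal (Real.exp (-z * (x : ℝ))) ∂m)) := by
  refine lintegral_tendsto_of_tendsto_of_monotone (fun n => by fun_prop)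
    (Eventually.of_forall fun x n k hnk => ?_) (Eventually.of_forall fun x => ?_)
  · refine ENNReal.ofReal_le_ofReal (sub_le_sub_left (Real.exp_le_exp.2 ?_) _)
    have hx : 0 < (x : ℝ) := x.2
    have : (n : ℝ) ≤ k := by exact_mod_cast hnk
    nlinarith
  · refine ENNReal.tendsto_ofReal ?_
    have hx : 0 < (x : ℝ) := x.2
    have h : Tendsto (fun n : ℕ => Real.exp (-(z + n) * (x : ℝ))) atTop (𝓝 0) := by
      refine Real.tendsto_exp_atBot.comp (Tendsto.atBot_mul_const hx ?_)
      exact tendsto_neg_atTop_atBot.comp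
        (tendsto_atTop_add_const_left _ z tendsto_natCast_atTop_atTop)
    simpa using h.const_sub (Real.exp (-z * (x : ℝ)))

/-- Letting `w → ∞` along `z + n`, monotone convergence recovers the Laplace transforms. -/
lemma measure_ext_of_lintegral_exp_sub_exp {m₁ m₂ : Measure PosReal}
    (hfin : ∀ z : ℝ, 0 < z → ∫⁻ x, ENNReal.ofReal (Real.exp (-z * (x : ℝ))) ∂m₁ ≠ ∞)
    (h : ∀ z w : ℝ, 0 < z → z ≤ w →
      ∫⁻ x : PosReal, ENNReal.ofReal (Real.exp (-z * (x : ℝ)) - Real.exp (-w * (x : ℝ))) ∂m₁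
        = ∫⁻ x : PosReal,
            ENNReal.ofReal (Real.exp (-z * (x : ℝ)) - Real.exp (-w * (x : ℝ))) ∂m₂) :
    m₁ = m₂ := by
  refine measure_posReal_ext_of_lintegral_exp_neg hfin fun z hz => ?_
  refine tendsto_nhds_unique (tendsto_lintegral_exp_sub_exp m₁ z) ?_
  refine (tendsto_lintegral_exp_sub_exp m₂ z).congr fun n => (h z _ hz ?_).symm
  simp

lemma lintegral_exp_sub_exp_scaleMeasure (hW : Ψ.IsScaleFunction W) {z w : ℝ} (hz : 0 < z)
    (hzw : z ≤ w) :
    ∫⁻ x : PosReal, ENNReal.ofReal (Real.exp (-z * (x : ℝ)) - Real.exp (-w * (x : ℝ)))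
        ∂(scaleMeasure W) = ENNReal.ofReal (∫ s in z..w, 1 / Ψ.psi s) := by
  have := sFinite_scaleMeasure W
  rw [← setLIntegral_laplaceDeriv_Ioc _ hzw,
    setLIntegral_laplaceDeriv_eq_ofReal (laplaceDeriv_scaleMeasure_ne_top hW) hz hzw]
  congr 1
  refine intervalIntegral.integral_congr fun s hs => ?_
  rw [uIcc_of_le hzw] at hs
  exact toReal_laplaceDeriv_scaleMeasure hW (hz.trans_le hs.1)

theorem isStationaryMeasure_scaleMeasure (hψ : Ψ.IntegralInvFinite) (hZ : IsCBProcess Ψ P Z)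
    (hW : Ψ.IsScaleFunction W) : IsStationaryMeasure P Z (scaleMeasure W) := by
  obtain ⟨u, hcum, hu⟩ := hZ.log_laplace
  refine (isStationaryMeasure_iff hZ _).2 ⟨isLocallyFiniteMeasure_scaleMeasure hψ hW,
    fun t _ => (measure_ext_of_lintegral_exp_sub_exp
      (fun z hz => lintegral_exp_scaleMeasure_ne_top hψ hW hz) fun z w hz hzw => ?_).symm⟩
  have hw := hz.trans_le hzw
  rw [lintegral_bind_posLaw_exp_sub_exp hZ t hu hz hzw,
    lintegral_exp_sub_exp_scaleMeasure hW hz hzw,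
    lintegral_exp_sub_exp_scaleMeasure hW (cumulant_pos hW hcum hz t.coe_nonneg)
      ((cumulant_strictMonoOn hW hcum t.coe_nonneg).monotoneOn hz hw hzw),
    integral_one_div_psi_cumulant_cumulant hW hcum hz hw t.coe_nonneg]

/-! ### Branching, extinction and a lower bound for compact sets. -/

lemma lintegral_exp_neg_map (hZ : IsCBProcess Ψ P Z) (x : PosReal) (t : ℝ≥0)
    (hu : ∀ (x : PosReal) (t : ℝ≥0) (z : ℝ), 0 < z →
      ∫ ω, Real.exp (-z * Z t ω) ∂(P x) = Real.exp (-(x : ℝ) * u (t : ℝ) z))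
    {z : ℝ} (hz : 0 < z) :
    ∫⁻ y, ENNReal.ofReal (Real.exp (-z * y)) ∂((P x).map (Z t))
      = ENNReal.ofReal (Real.exp (-(x : ℝ) * u t z)) := by
  rw [lintegral_map (by fun_prop) (hZ.measurable t).measurable, ← hu x t z hz,
    ofReal_integral_eq_lintegral_ofReal (integrable_exp_neg_mul hZ x t hz.le)
      (Eventually.of_forall fun ω => (Real.exp_pos _).le)]

/-- The branching property. -/
lemma map_conv_map (hZ : IsCBProcess Ψ P Z) (x y : PosReal) (t : ℝ≥0) :
    ((P x).map (Z t)).conv ((P y).map (Z t))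
      = (P ⟨(x : ℝ) + y, mem_Ioi.2 (add_pos x.2 y.2)⟩).map (Z t) := by
  obtain ⟨u, -, hu⟩ := hZ.log_laplace
  have := hZ.isProbabilityMeasure x
  have := hZ.isProbabilityMeasure y
  have key : ∀ z : ℝ, 0 < z →
      ∫⁻ s, ENNReal.ofReal (Real.exp (-z * s)) ∂(((P x).map (Z t)).conv ((P y).map (Z t)))
        = ENNReal.ofReal (Real.exp (-((x : ℝ) + y) * u t z)) := by
    intro z hz
    rw [Measure.lintegral_conv (by fun_prop)]
    have h : ∀ a b : ℝ, ENNReal.ofReal (Real.exp (-z * (a + b)))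
        = ENNReal.ofReal (Real.exp (-z * a)) * ENNReal.ofReal (Real.exp (-z * b)) := fun a b => by
      rw [← ENNReal.ofReal_mul (Real.exp_pos _).le, ← Real.exp_add, mul_add]
    simp_rw [h]
    simp_rw [lintegral_const_mul' _ _ ENNReal.ofReal_ne_top, lintegral_exp_neg_map hZ y t hu hz]
    rw [lintegral_mul_const' _ _ ENNReal.ofReal_ne_top, lintegral_exp_neg_map hZ x t hu hz,
      ← ENNReal.ofReal_mul (Real.exp_pos _).le, ← Real.exp_add]
    ring_nf
  refine Measure_ext_of_lintegral_exp_neg (fun z hz => ?_) fun z hz => ?_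
  · rw [key z hz]; exact ENNReal.ofReal_ne_top
  · rw [key z hz, lintegral_exp_neg_map hZ _ t hu hz]

lemma tendsto_integral_exp_neg_mul_nat (hZ : IsCBProcess Ψ P Z) (x : PosReal) (t : ℝ≥0) :
    Tendsto (fun n : ℕ => ∫ ω, Real.exp (-((n : ℝ) + 1) * Z t ω) ∂(P x)) atTop
      (𝓝 ((P x).real {ω | Z t ω = 0})) := by
  have := hZ.isProbabilityMeasure x
  have hm := (hZ.measurable t).measurable
  have hS : MeasurableSet {ω | Z t ω = 0} := hm (measurableSet_singleton 0)
  rw [← integral_indicator_one hS]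
  refine tendsto_integral_of_dominated_convergence (fun _ => 1) (fun n => by fun_prop)
    (integrable_const 1) (fun n => Eventually.of_forall fun ω => ?_)
    (Eventually.of_forall fun ω => ?_)
  · rw [Real.norm_of_nonneg (Real.exp_pos _).le, Real.exp_le_one_iff]
    have : 0 ≤ ((n : ℝ) + 1) * Z t ω := mul_nonneg (by positivity) (hZ.nonneg t ω)
    linarith
  · rcases (hZ.nonneg t ω).eq_or_lt with h | h
    · simp [← h]
    · rw [indicator_of_notMem (by simpa using h.ne')]
      refine Real.tendsto_exp_atBot.comp (Tendsto.atBot_mul_const h ?_)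
      exact tendsto_neg_atTop_atBot.comp
        (tendsto_atTop_add_const_right _ 1 tendsto_natCast_atTop_atTop)

/-- If the cumulant at time `t` is bounded by `v`, it increases to a limit `U ≤ v`, and `U` governs
the extinction probabilities at time `t`. -/
lemma exists_tendsto_cumulant (hZ : IsCBProcess Ψ P Z) (hW : Ψ.IsScaleFunction W)
    (hcum : Ψ.IsCumulant u)
    (hu : ∀ (x : PosReal) (t : ℝ≥0) (z : ℝ), 0 < z →
      ∫ ω, Real.exp (-z * Z t ω) ∂(P x) = Real.exp (-(x : ℝ) * u (t : ℝ) z))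
    {t : ℝ≥0} {v : ℝ} (hv : ∀ w : ℝ, 0 < w → u t w ≤ v) :
    ∃ U : ℝ, U ≤ v ∧ (∀ w : ℝ, 0 < w → u t w < U) ∧
      Tendsto (fun n : ℕ => u t (n + 1)) atTop (𝓝 U) ∧
      ∀ x : PosReal, (P x).real {ω | Z t ω = 0} = Real.exp (-(x : ℝ) * U) := by
  have hpos : ∀ n : ℕ, (0 : ℝ) < n + 1 := fun n => by positivity
  have hmono := cumulant_strictMonoOn hW hcum t.coe_nonneg
  have hmonoN : Monotone fun n : ℕ => u t (n + 1) := fun n k hnk =>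
    hmono.monotoneOn (hpos n) (hpos k) (by gcongr)
  obtain ⟨U, hU⟩ : ∃ U, Tendsto (fun n : ℕ => u t (n + 1)) atTop (𝓝 U) :=
    ⟨_, tendsto_atTop_ciSup hmonoN ⟨v, by rintro _ ⟨n, rfl⟩; exact hv _ (hpos n)⟩⟩
  refine ⟨U, le_of_tendsto' hU fun n => hv _ (hpos n), fun w hw => ?_, hU, fun x => ?_⟩
  · obtain ⟨n, hn⟩ := exists_nat_gt w
    refine (hmono hw (hpos n) (hn.trans (lt_add_one _))).trans_le ?_
    exact hmonoN.ge_of_tendsto hU n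
  · refine tendsto_nhds_unique (tendsto_integral_exp_neg_mul_nat hZ x t) ?_
    simp_rw [fun n : ℕ => hu x t _ (hpos n)]
    exact (Real.continuous_exp.tendsto _).comp (hU.const_mul _)

/-- Together with `le_exp_sub_exp` this shows that such differences are of exact order `x` for small
starting points, so the error terms in `exists_le_measure_Icc` can be compared with the main term.
-/
lemma exp_sub_exp_le {x q U : ℝ} (hx : 0 ≤ x) (hq : 0 ≤ q) (hqU : q ≤ U) :
    Real.exp (-x * q) - Real.exp (-x * U) ≤ x * (U - q) := by
  have h1 : Real.exp (-x * U) = Real.exp (-x * q) * Real.exp (-(x * (U - q))) := by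
    rw [← Real.exp_add]; ring_nf
  have h2 : Real.exp (-x * q) ≤ 1 := Real.exp_le_one_iff.2 (by nlinarith)
  have h3 := Real.add_one_le_exp (-(x * (U - q)))
  have h4 : 0 ≤ x * (U - q) := mul_nonneg hx (by linarith)
  have h5 := Real.exp_pos (-x * q)
  rw [h1]
  nlinarith [mul_le_mul_of_nonneg_left h3 h5.le]

lemma le_exp_sub_exp {x q U : ℝ} (hx : 0 ≤ x) (hx1 : x ≤ 1) (hU : 0 ≤ U) (hqU : q ≤ U) :
    x * ((U - q) * Real.exp (-U)) ≤ Real.exp (-x * q) - Real.exp (-x * U) := by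
  have h1 : Real.exp (-x * q) = Real.exp (-x * U) * Real.exp (x * (U - q)) := by
    rw [← Real.exp_add]; ring_nf
  have h2 : Real.exp (-U) ≤ Real.exp (-x * U) := Real.exp_le_exp.2 (by nlinarith)
  have h3 := Real.add_one_le_exp (x * (U - q))
  have h4 : 0 ≤ x * (U - q) := mul_nonneg hx (by linarith)
  rw [h1]
  nlinarith [mul_le_mul_of_nonneg_left h3 (Real.exp_pos (-x * U)).le,
    mul_le_mul_of_nonneg_left h2 h4]

/-- Three ranges for `y > 0`: below `1/w` use `e^{-y} ≤ 1 ≤ e · e^{-wy}`, above `b` use `e^{-y} ≤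
e^{-b/2} e^{-y/2}`, and in between `e^{-y} ≤ 1`. The indicators of `{0}` cancel the exponentials at
`y = 0`. -/
lemma exp_neg_sub_indicator_le {w b y : ℝ} (hw : 0 < w) (hy : 0 ≤ y) :
    Real.exp (-1 * y) - ({0} : Set ℝ).indicator 1 y
      ≤ (Icc (1 / w) b).indicator 1 y
        + Real.exp 1 * (Real.exp (-w * y) - ({0} : Set ℝ).indicator 1 y)
        + Real.exp (-(b / 2)) * (Real.exp (-(1 / 2) * y) - ({0} : Set ℝ).indicator 1 y) := by
  have hI : (0 : ℝ) ≤ (Icc (1 / w) b).indicator 1 y := indicator_nonneg (fun _ _ => zero_le_one) _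
  rcases hy.eq_or_lt with rfl | hy
  · simpa using hI
  have h0 : ({0} : Set ℝ).indicator (1 : ℝ → ℝ) y = 0 :=
    indicator_of_notMem (by simpa using hy.ne') _
  have hA : Real.exp 1 * Real.exp (-w * y) = Real.exp (1 - w * y) := by
    rw [← Real.exp_add]; ring_nf
  have hB : Real.exp (-(b / 2)) * Real.exp (-(1 / 2) * y) = Real.exp (-(b / 2) - y / 2) := by
    rw [← Real.exp_add]; ring_nf
  rw [h0]
  simp only [sub_zero, hA, hB]
  have pA := Real.exp_pos (1 - w * y)
  have pB := Real.exp_pos (-(b / 2) - y / 2)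
  by_cases h1 : y < 1 / w
  · have : w * y < 1 := by rwa [lt_div_iff₀ hw, mul_comm] at h1
    have : Real.exp (-1 * y) ≤ Real.exp (1 - w * y) := Real.exp_le_exp.2 (by linarith)
    linarith
  by_cases h2 : b < y
  · have : Real.exp (-1 * y) ≤ Real.exp (-(b / 2) - y / 2) := Real.exp_le_exp.2 (by linarith)
    linarith
  · rw [indicator_of_mem (show y ∈ Icc (1 / w) b from ⟨not_lt.1 h1, not_lt.1 h2⟩)]
    have : Real.exp (-1 * y) ≤ 1 := Real.exp_le_one_iff.2 (by linarith)
    simp only [Pi.one_apply]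
    linarith

lemma exp_sub_exp_le_measure_Icc (hZ : IsCBProcess Ψ P Z) (x : PosReal) (t : ℝ≥0)
    (hu : ∀ (x : PosReal) (t : ℝ≥0) (z : ℝ), 0 < z →
      ∫ ω, Real.exp (-z * Z t ω) ∂(P x) = Real.exp (-(x : ℝ) * u (t : ℝ) z))
    {U w b : ℝ} (hw : 0 < w) (hU : (P x).real {ω | Z t ω = 0} = Real.exp (-(x : ℝ) * U)) :
    Real.exp (-(x : ℝ) * u t 1) - Real.exp (-(x : ℝ) * U)
      ≤ (P x).real {ω | Z t ω ∈ Icc (1 / w) b}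
        + Real.exp 1 * (Real.exp (-(x : ℝ) * u t w) - Real.exp (-(x : ℝ) * U))
        + Real.exp (-(b / 2)) * (Real.exp (-(x : ℝ) * u t (1 / 2)) - Real.exp (-(x : ℝ) * U)) := by
  have := hZ.isProbabilityMeasure x
  have hm := (hZ.measurable t).measurable
  have hind : ∀ {S : Set ℝ}, MeasurableSet S →
      Integrable (fun ω => S.indicator (1 : ℝ → ℝ) (Z t ω)) (P x) ∧
      ∫ ω, S.indicator (1 : ℝ → ℝ) (Z t ω) ∂(P x) = (P x).real {ω | Z t ω ∈ S} := by
    intro S hS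
    exact ⟨(integrable_const (1 : ℝ)).indicator (hm hS), integral_indicator_one (hm hS)⟩
  obtain ⟨i0, e0⟩ := hind (measurableSet_singleton (0 : ℝ))
  obtain ⟨iI, eI⟩ := hind (measurableSet_Icc (a := 1 / w) (b := b))
  have hexp := fun (z : ℝ) (hz : 0 < z) => integrable_exp_neg_mul hZ x t hz.le
  have hE : ∀ z : ℝ, 0 < z → ∫ ω, (Real.exp (-z * Z t ω)
      - ({0} : Set ℝ).indicator 1 (Z t ω)) ∂(P x)
      = Real.exp (-(x : ℝ) * u t z) - Real.exp (-(x : ℝ) * U) := by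
    intro z hz
    rw [integral_sub (hexp z hz) i0, hu x t z hz, e0]
    simp only [mem_singleton_iff, hU]
  have h1 := (hexp 1 one_pos).sub i0
  have h2 := ((hexp w hw).sub i0).const_mul (Real.exp 1)
  have h3 := ((hexp (1 / 2) (by norm_num)).sub i0).const_mul (Real.exp (-(b / 2)))
  have key := integral_mono h1 ((iI.add h2).add h3) fun ω =>
    exp_neg_sub_indicator_le (b := b) hw (hZ.nonneg t ω)
  have e1 := integral_add (iI.add h2) h3
  have e2 := integral_add iI h2
  simp only [Pi.add_apply, Pi.sub_apply] at key e1 e2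
  rw [e1, e2, integral_const_mul, integral_const_mul, hE _ one_pos, hE _ hw,
    hE _ (by norm_num), eI] at key
  exact key

/-- A lower bound for the probability of a compact set, linear in small starting points. -/
lemma exists_le_measure_Icc (hZ : IsCBProcess Ψ P Z) (hW : Ψ.IsScaleFunction W)
    (hcum : Ψ.IsCumulant u)
    (hu : ∀ (x : PosReal) (t : ℝ≥0) (z : ℝ), 0 < z →
      ∫ ω, Real.exp (-z * Z t ω) ∂(P x) = Real.exp (-(x : ℝ) * u (t : ℝ) z))
    {t : ℝ≥0} {v : ℝ} (hv : ∀ w : ℝ, 0 < w → u t w ≤ v) :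
    ∃ a b c : ℝ, 0 < a ∧ 0 < c ∧ ∀ x : PosReal,
      c * (min (x : ℝ) 1 * Real.exp (-v * (x : ℝ))) ≤ (P x).real {ω | Z t ω ∈ Icc a b} := by
  obtain ⟨U, hUv, hlt, hlim, hext⟩ := exists_tendsto_cumulant hZ hW hcum hu hv
  have hU : 0 < U := (cumulant_pos hW hcum one_pos t.coe_nonneg).trans (hlt 1 one_pos)
  -- For `x ≤ 1` the main term is at least `δx`. Taking `w = n + 1` and `b` large makes each of the
  -- two error terms at most `δx/4`, which leaves `δx/2` for the compact interval.
  set δ := (U - u t 1) * Real.exp (-U) with hδ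
  have hδ0 : 0 < δ := mul_pos (sub_pos.2 (hlt 1 one_pos)) (Real.exp_pos _)
  obtain ⟨n, hn⟩ : ∃ n : ℕ, Real.exp 1 * (U - u t (n + 1)) < δ / 4 := by
    have h : Tendsto (fun n : ℕ => Real.exp 1 * (U - u t (n + 1))) atTop (𝓝 0) := by
      simpa using (hlim.const_sub U).const_mul (Real.exp 1)
    exact (h.eventually_lt_const (by positivity)).exists
  obtain ⟨b, hb⟩ : ∃ b : ℝ, Real.exp (-(b / 2)) * U < δ / 4 := by
    have h : Tendsto (fun b : ℝ => Real.exp (-(b / 2)) * U) atTop (𝓝 0) := by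
      have := (Real.tendsto_exp_neg_atTop_nhds_zero.comp
        (tendsto_id.atTop_div_const (two_pos : (0 : ℝ) < 2))).mul_const U
      simpa using this
    exact (h.eventually_lt_const (by positivity)).exists
  have hw : (0 : ℝ) < n + 1 := by positivity
  have hsmall : ∀ x : PosReal, (x : ℝ) ≤ 1 →
      δ / 2 * (x : ℝ) ≤ (P x).real {ω | Z t ω ∈ Icc (1 / ((n : ℝ) + 1)) b} := by
    intro x hx1
    have hx : 0 < (x : ℝ) := x.2
    have h := exp_sub_exp_le_measure_Icc hZ x t hu (b := b) hw (hext x)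
    have l1 := le_exp_sub_exp hx.le hx1 hU.le (hlt 1 one_pos).le
    have l2 := exp_sub_exp_le hx.le (cumulant_pos hW hcum hw t.coe_nonneg).le (hlt _ hw).le
    have l3 := exp_sub_exp_le hx.le (cumulant_pos hW hcum (z := 1 / 2) (by norm_num) t.coe_nonneg).le
      (hlt (1 / 2) (by norm_num)).le
    have l4 := cumulant_pos hW hcum (z := 1 / 2) (by norm_num) t.coe_nonneg
    have m2 := mul_le_mul_of_nonneg_left l2 (Real.exp_pos 1).le
    have m3 := mul_le_mul_of_nonneg_left
      (l3.trans (mul_le_mul_of_nonneg_left (sub_le_self U l4.le) hx.le))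
      (Real.exp_pos (-(b / 2))).le
    have n2 := mul_le_mul_of_nonneg_left hn.le hx.le
    have n3 := mul_le_mul_of_nonneg_left hb.le hx.le
    rw [← hδ] at l1
    linarith
  refine ⟨1 / ((n : ℝ) + 1), b, δ / 2, by positivity, by positivity, fun x => ?_⟩
  have hx : 0 < (x : ℝ) := x.2
  have hv0 : 0 < v := hU.trans_le hUv
  rcases le_or_gt (x : ℝ) 1 with h1 | h1
  · refine le_trans ?_ (hsmall x h1)
    rw [min_eq_left h1]
    have : Real.exp (-v * (x : ℝ)) ≤ 1 := Real.exp_le_one_iff.2 (by nlinarith)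
    have := mul_le_mul_of_nonneg_left this hx.le
    have := mul_le_mul_of_nonneg_left this (half_pos hδ0).le
    linarith
  · rw [min_eq_right h1.le, one_mul]
    -- For `x > 1`, branching splits the population into independent parts started from `1` and `x -
    -- 1`. It suffices that the first lands in the interval and the second is extinct, the latter
    -- with probability `e^{-(x-1)U} ≥ e^{-vx}`.
    set o : PosReal := ⟨1, mem_Ioi.2 one_pos⟩ with ho
    set y : PosReal := ⟨(x : ℝ) - 1, mem_Ioi.2 (sub_pos.2 h1)⟩ with hy
    have hxy : (⟨(o : ℝ) + y, mem_Ioi.2 (add_pos o.2 y.2)⟩ : PosReal) = x := Subtype.ext (by simp [ho, hy])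
    have hbr := map_conv_map hZ o y t
    rw [hxy] at hbr
    have hm := (hZ.measurable t).measurable
    have := hZ.isProbabilityMeasure o
    have := hZ.isProbabilityMeasure y
    have := hZ.isProbabilityMeasure x
    set I := Icc (1 / ((n : ℝ) + 1)) b with hI
    have hmul : P o {ω | Z t ω ∈ I} * P y {ω | Z t ω = 0} ≤ P x {ω | Z t ω ∈ I} := by
      have hIm : MeasurableSet I := measurableSet_Icc
      calc P o {ω | Z t ω ∈ I} * P y {ω | Z t ω = 0}
          = (((P o).map (Z t)).prod ((P y).map (Z t))) (I ×ˢ {0}) := by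
            rw [Measure.prod_prod, Measure.map_apply hm hIm,
              Measure.map_apply hm (measurableSet_singleton 0)]
            rfl
        _ ≤ (((P o).map (Z t)).prod ((P y).map (Z t)))
              ((fun p : ℝ × ℝ => p.1 + p.2) ⁻¹' I) := by
            refine measure_mono ?_
            rintro ⟨p, q⟩ ⟨hp, hq⟩
            have hq' : q = 0 := hq
            simpa [hq'] using hp
        _ = (((P o).map (Z t)).conv ((P y).map (Z t))) I := by
            rw [Measure.conv, Measure.map_apply (by fun_prop) hIm]
        _ = P x {ω | Z t ω ∈ I} := by
            rw [hbr, Measure.map_apply hm hIm]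
            rfl
    have hreal : (P o).real {ω | Z t ω ∈ I} * (P y).real {ω | Z t ω = 0}
        ≤ (P x).real {ω | Z t ω ∈ I} := by
      rw [Measure.real, Measure.real, Measure.real, ← ENNReal.toReal_mul]
      exact ENNReal.toReal_mono (measure_ne_top _ _) hmul
    have ho1 := hsmall o le_rfl
    refine le_trans ?_ hreal
    rw [hext y]
    have he : Real.exp (-v * (x : ℝ)) ≤ Real.exp (-(y : ℝ) * U) := by
      refine Real.exp_le_exp.2 ?_
      simp only [hy]
      nlinarith
    have ho1' : δ / 2 ≤ (P o).real {ω | Z t ω ∈ I} := by simpa [ho] using ho1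
    exact mul_le_mul ho1' he (Real.exp_pos _).le measureReal_nonneg

/-- Half of the exponential absorbs the growth of `x`, since `vx ≤ e^{vx}` gives `x e^{-vx} ≤ 1/v`.
-/
lemma mul_exp_le_min_mul_exp {v x : ℝ} (hv : 0 < v) (hx : 0 < x) :
    x * Real.exp (-(2 * v) * x) ≤ (1 + 1 / v) * (min x 1 * Real.exp (-v * x)) := by
  have h1 : Real.exp (-(2 * v) * x) = Real.exp (-v * x) * Real.exp (-v * x) := by
    rw [← Real.exp_add]; ring_nf
  have h2 : Real.exp (-v * x) ≤ 1 := Real.exp_le_one_iff.2 (by nlinarith)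
  have h3 : x * Real.exp (-v * x) ≤ 1 / v := by
    have h4 := Real.add_one_le_exp (v * x)
    have h5 : Real.exp (-v * x) * Real.exp (v * x) = 1 := by rw [← Real.exp_add]; simp
    have h6 := Real.exp_pos (-v * x)
    rw [le_div_iff₀ hv]
    nlinarith
  have h7 : x * Real.exp (-v * x) ≤ (1 + 1 / v) * min x 1 := by
    have hv' : 0 < 1 / v := by positivity
    rcases le_total x 1 with h | h
    · rw [min_eq_left h]
      nlinarith
    · rw [min_eq_right h]
      linarith
  rw [h1]
  nlinarith [mul_le_mul_of_nonneg_right h7 (Real.exp_pos (-v * x)).le]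

/-! ### Uniqueness of the stationary measure. -/

/-- With `v = z/2` and a time `t` at which the cumulant is below `v`, stationarity on a compact `[a,
b]` gives `ν[a,b] ≥ c ∫ (x ∧ 1) e^{-vx} ν(dx)`, and this integral dominates a multiple of `∫ x
e^{-zx} ν(dx)`. As `a > 0`, the Radon property makes `ν[a,b]` finite. -/
lemma laplaceDeriv_ne_top_of_isStationaryMeasure (hψ : Ψ.IntegralInvFinite)
    (hZ : IsCBProcess Ψ P Z) (hW : Ψ.IsScaleFunction W) {ν : Measure PosReal}
    (hν : IsStationaryMeasure P Z ν) {z : ℝ} (hz : 0 < z) : laplaceDeriv ν z ≠ ∞ := by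
  obtain ⟨u, hcum, hu⟩ := hZ.log_laplace
  obtain ⟨t, ht, hv⟩ := exists_cumulant_le hψ hW hcum (half_pos hz)
  obtain ⟨a, b, c, ha, hc, hle⟩ := exists_le_measure_Icc hZ hW hcum hu hv
  have hv0 := half_pos hz
  have hloc := hν.isLocallyFinite
  set A : Set PosReal := {y | (y : ℝ) ∈ Icc a b} with hA
  have himage : ((↑) : PosReal → ℝ) '' A = Icc a b := by
    rw [hA]
    exact Subtype.image_preimage_coe _ _ |>.trans
      (inter_eq_right.2 fun s hs => ha.trans_le hs.1)
  have hAc : IsCompact A := by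
    rw [Subtype.isCompact_iff, himage]
    exact isCompact_Icc
  have hstat := hν.stationary t ht A (measurable_subtype_coe measurableSet_Icc)
  rw [himage] at hstat
  set K : ℝ := (1 + 1 / (z / 2)) / c with hK
  have hK0 : 0 < K := by positivity
  refine ne_top_of_le_ne_top
    (ENNReal.mul_ne_top (ENNReal.ofReal_ne_top (r := K)) (hAc.measure_lt_top (μ := ν)).ne) ?_
  rw [← hstat, ← lintegral_const_mul' _ _ ENNReal.ofReal_ne_top]
  refine lintegral_mono fun x => ?_
  have := hZ.isProbabilityMeasure x
  have hx : 0 < (x : ℝ) := x.2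
  rw [← ofReal_measureReal (measure_ne_top _ _), ← ENNReal.ofReal_mul hK0.le]
  refine ENNReal.ofReal_le_ofReal ?_
  have h1 := mul_exp_le_min_mul_exp hv0 hx
  have h2 := mul_le_mul_of_nonneg_left (hle x) hK0.le
  have h3 : K * (c * (min (x : ℝ) 1 * Real.exp (-(z / 2) * (x : ℝ))))
      = (1 + 1 / (z / 2)) * (min (x : ℝ) 1 * Real.exp (-(z / 2) * (x : ℝ))) := by
    rw [hK]; field_simp
  rw [h3] at h2
  refine le_trans (le_of_eq ?_) (h1.trans h2)
  ring_nf

/-- For a stationary measure the derivative of the Laplace transform is a multiple of `1 / ψ`. -/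
lemma laplaceDeriv_mul_psi_eq (hZ : IsCBProcess Ψ P Z) (hW : Ψ.IsScaleFunction W)
    {ν : Measure PosReal} (hν : IsStationaryMeasure P Z ν)
    (hfin : ∀ z : ℝ, 0 < z → laplaceDeriv ν z ≠ ∞) {z w : ℝ} (hz : 0 < z) (hzw : z ≤ w) :
    (laplaceDeriv ν w).toReal * Ψ.psi w = (laplaceDeriv ν z).toReal * Ψ.psi z := by
  obtain ⟨u, hcum, hu⟩ := hZ.log_laplace
  have hloc := hν.isLocallyFinite
  have := isOpen_Ioi.locallyCompactSpace (X := ℝ) (s := Ioi 0)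
  have hw := hz.trans_le hzw
  set h : ℝ → ℝ := fun s => (laplaceDeriv ν s).toReal with hh
  have hc : ContinuousOn h (Ioi 0) := continuousOn_toReal_laplaceDeriv hfin
  -- Stationarity as flow invariance of `h(s) ds`. The time `t = 0`, where the derivative is taken
  -- below, is covered by the initial condition.
  have hconst : ∀ t : ℝ, 0 ≤ t → ∫ s in u t z..u t w, h s = ∫ s in z..w, h s := by
    intro t ht
    rcases ht.eq_or_lt with rfl | ht'
    · rw [(hcum z hz).1, (hcum w hw).1]
    have hpz := cumulant_pos hW hcum hz ht
    have hmono : u t z ≤ u t w := (cumulant_strictMonoOn hW hcum ht).monotoneOn hz hw hzw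
    have h1 := lintegral_bind_posLaw_exp_sub_exp hZ (NNReal.mk t ht) hu hz hzw ν
    rw [((isStationaryMeasure_iff hZ ν).1 hν).2 (NNReal.mk t ht) ht', NNReal.coe_mk,
      ← setLIntegral_laplaceDeriv_Ioc _ hzw, ← setLIntegral_laplaceDeriv_Ioc _ hmono,
      setLIntegral_laplaceDeriv_eq_ofReal hfin hz hzw,
      setLIntegral_laplaceDeriv_eq_ofReal hfin hpz hmono] at h1
    exact ((ENNReal.ofReal_eq_ofReal_iff
      (intervalIntegral.integral_nonneg hzw fun _ _ => ENNReal.toReal_nonneg)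
      (intervalIntegral.integral_nonneg hmono fun _ _ => ENNReal.toReal_nonneg)).1 h1).symm
  have hder : ∀ y : ℝ, 0 < y → HasDerivWithinAt (fun t => ∫ s in z..u t y, h s)
      (h y * -Ψ.psi y) (Ici 0) 0 := by
    intro y hy
    have hd := ((hcum y hy).2 0 le_rfl).2
    have hy0 : 0 < u 0 y := by rw [(hcum y hy).1]; exact hy
    have := (hasDerivAt_integral_of_continuousOn_Ioi hc hz hy0).comp_hasDerivWithinAt 0 hd
    rwa [(hcum y hy).1] at this
  have hdiff := (hder w hw).sub (hder z hz)
  -- The same function of `t` is constant and has right derivative `h(z)ψ(z) - h(w)ψ(w)` at `0`, so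
  -- this number vanishes.
  have hzero : HasDerivWithinAt (fun _ : ℝ => ∫ s in z..w, h s)
      (h w * -Ψ.psi w - h z * -Ψ.psi z) (Ici 0) 0 := by
    have hsub : ∀ t ∈ Ici (0 : ℝ),
        ∫ s in z..w, h s = (∫ s in z..u t w, h s) - ∫ s in z..u t z, h s := by
      intro t ht
      have pw := cumulant_pos hW hcum hw ht
      have pz := cumulant_pos hW hcum hz ht
      rw [intervalIntegral.integral_interval_sub_left
        (intervalIntegrable_of_continuousOn_Ioi hc hz pw)
        (intervalIntegrable_of_continuousOn_Ioi hc hz pz), hconst t ht]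
    exact hdiff.congr hsub (hsub 0 self_mem_Ici)
  have := (uniqueDiffWithinAt_Ici (0 : ℝ)).eq_deriv _ hzero (hasDerivWithinAt_const _ _ _)
  linarith

lemma laplaceDeriv_smul (c : ℝ≥0) (ν : Measure PosReal) (z : ℝ) :
    laplaceDeriv (c • ν) z = c * laplaceDeriv ν z := by
  rw [laplaceDeriv, lintegral_smul_measure]
  rfl

theorem exists_eq_smul_scaleMeasure (hψ : Ψ.IntegralInvFinite) (hZ : IsCBProcess Ψ P Z)
    (hW : Ψ.IsScaleFunction W) {ν : Measure PosReal} (hν : IsStationaryMeasure P Z ν) :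
    ∃ c : ℝ≥0, ν = c • scaleMeasure W := by
  have hfin : ∀ z : ℝ, 0 < z → laplaceDeriv ν z ≠ ∞ := fun z hz =>
    laplaceDeriv_ne_top_of_isStationaryMeasure hψ hZ hW hν hz
  have hc0 : 0 ≤ (laplaceDeriv ν 1).toReal * Ψ.psi 1 :=
    mul_nonneg ENNReal.toReal_nonneg (psi_pos hW one_pos).le
  -- The constant is the value at `z = 1` of the conserved product `laplaceDeriv ν z · ψ(z)`.
  refine ⟨NNReal.mk _ hc0, eq_of_laplaceDeriv_eq hfin fun z hz => ?_⟩
  have hconst : (laplaceDeriv ν z).toReal * Ψ.psi z = (laplaceDeriv ν 1).toReal * Ψ.psi 1 := by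
    rcases le_total z 1 with h | h
    · exact (laplaceDeriv_mul_psi_eq hZ hW hν hfin hz h).symm
    · exact laplaceDeriv_mul_psi_eq hZ hW hν hfin one_pos h
  rw [laplaceDeriv_smul, laplaceDeriv_scaleMeasure hW hz, ← ENNReal.ofReal_toReal (hfin z hz),
    ← ENNReal.ofReal_coe_nnreal, ← ENNReal.ofReal_mul NNReal.zero_le_coe, NNReal.coe_mk, ← hconst]
  have := (psi_pos hW hz).ne'
  congr 1
  field_simp

end CBProcess

open CBProcess in
theorem mainTheorem3 (Ψ : BranchingMechanism) (hα : Ψ.IsCriticalOrSubcritical)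
    (hψ : Ψ.IntegralInvFinite)
    {Ω : Type*} [MeasurableSpace Ω] (P : PosReal → Measure Ω) (Z : ℝ≥0 → Ω → ℝ)
    (hZ : IsCBProcess Ψ P Z) (W : ℝ → ℝ) (hW : Ψ.IsScaleFunction W) :
    IsStationaryMeasure P Z (scaleMeasure W) ∧ scaleMeasure W ≠ 0 ∧
      ∀ ν : Measure PosReal, IsStationaryMeasure P Z ν →
        ∃ c : ℝ≥0, ν = c • scaleMeasure W := by
  exact ⟨isStationaryMeasure_scaleMeasure hψ hZ hW, scaleMeasure_ne_zero hW,
    fun _ hν => exists_eq_smul_scaleMeasure hψ hZ hW hν⟩
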